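/- Let $p\ge 1$ and $N\ge 2$ be integers, let $s_n>0$ ($n\ge 1$) with $\sum_n s_n<\infty$, and for every $n\ge 1$ let $\mathcal D^n=\{d^n_1,\dots,d^n_N\}\subset\mathbb R^p$ be a digit set containing $0$ ($0=d^n_1$). Put $$C_{s,\mathcal D}=\Big\{\sum_{i=1}^\infty s_i b_i : b_i\in\mathcal D^i \text{ for all } i\Big\},\qquad R_n=\sum_{i>n}s_i,$$ $$\kappa=\sup_n\max_{i\ne j}\|d^n_i-d^n_j\|,\qquad \tau=\inf_n\min_{i\ne j}\|d^n_i-d^n_j\|,$$ where $\|\cdot\|$ is the Euclidean norm, and assume that $\kappa<\infty$, $\tau>0$ and $$\sup_n\frac{\kappa R_n}{\tau s_n}<1 .$$ Then $$\dim_H(C_{s,\mathcal D})=\liminf_{n\to\infty}\frac{-n\ln N}{\ln s_n}\qquad\text{and}\qquad \dim_P(C_{s,\mathcal D})=\limsup_{n\to\infty}\frac{-n\ln N}{\ln s_n},$$ where $\dim_H$ is the Hausdorff dimension and $\dim_P$ is the packing dimension, that is, $\dim_P(E)=\sup\{t\ge 0:\mathcal P^t(E)=\infty\}$ ($0$ if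 there is no such $t$), with $$\mathcal P^t(E)=\inf\Big\{\sum_{i=1}^\infty \mathcal P^t_0(E_i) : E\subseteq\bigcup_i E_i\Big\},\qquad \mathcal P^t_0(E)=\lim_{\delta\to0+}\sup\sum_i |B_i|^t,$$ the supremum being over all families of pairwise disjoint open balls $B_i$ with centres in $E$ and radii in $(0,\delta]$, and $|B_i|$ denoting the diameter. -/

import Mathlib

open Filter
open scoped ENNReal NNReal

/-- A `δ`-packing of `E`: a family of pairwise disjoint open balls, each given by its centre
`b.1 ∈ E` and its radius `0 < b.2 ≤ δ`. -/
def IsPacking {X : Type*} [MetricSpace X] (δ : ℝ) (E : Set X) (P : Set (X × ℝ)) : Prop :=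
  (∀ b ∈ P, b.1 ∈ E ∧ 0 < b.2 ∧ b.2 ≤ δ) ∧
    P.PairwiseDisjoint (fun b => Metric.ball b.1 b.2)

/-- The supremum of `∑ |B|^t` over all `δ`-packings of `E`, where `|B|` is the diameter of the
ball `B`. -/
noncomputable def packingSup {X : Type*} [MetricSpace X] (t : ℝ≥0) (δ : ℝ) (E : Set X) : ℝ≥0∞ :=
  ⨆ (P : Set (X × ℝ)) (_ : IsPacking δ E P),
    ∑' b : P, Metric.ediam (Metric.ball b.1.1 b.1.2) ^ (t : ℝ)

/-- The `t`-dimensional packing pre-measure: the limit of `packingSup t δ E` as `δ → 0+`, which is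
an infimum because `packingSup t δ E` is nondecreasing in `δ`. -/
noncomputable def packingPremeasure {X : Type*} [MetricSpace X] (t : ℝ≥0) (E : Set X) : ℝ≥0∞ :=
  ⨅ (δ : ℝ) (_ : 0 < δ), packingSup t δ E

/-- The `t`-dimensional packing (outer) measure. -/
noncomputable def packingMeasure {X : Type*} [MetricSpace X] (t : ℝ≥0) (E : Set X) : ℝ≥0∞ :=
  ⨅ (F : ℕ → Set X) (_ : E ⊆ ⋃ i, F i), ∑' i, packingPremeasure t (F i)

/-- The packing dimension `sup {t ≥ 0 : 𝒫^t(E) = ∞}` (with supremum `0` if there is no such `t`);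
this is the analogue of Mathlib's Hausdorff dimension `dimH`. -/
noncomputable def dimP {X : Type*} [MetricSpace X] (E : Set X) : ℝ≥0∞ :=
  ⨆ (t : ℝ≥0) (_ : packingMeasure t E = ∞), (t : ℝ≥0∞)

/-- The largest distance between two digits of the digit set `{e 1, …, e N}` with different
indices. -/
noncomputable def maxGap {p N : ℕ} (e : Fin N → EuclideanSpace ℝ (Fin p)) : ℝ :=
  ⨆ q : {q : Fin N × Fin N // q.1 ≠ q.2}, ‖e q.1.1 - e q.1.2‖

/-- The smallest distance between two digits of the digit set `{e 1, …, e N}` with different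
indices. -/
noncomputable def minGap {p N : ℕ} (e : Fin N → EuclideanSpace ℝ (Fin p)) : ℝ :=
  ⨅ q : {q : Fin N × Fin N // q.1 ≠ q.2}, ‖e q.1.1 - e q.1.2‖

/-- `κ = sup_n κ_n`. -/
noncomputable def kappa {p N : ℕ} (d : ℕ → Fin N → EuclideanSpace ℝ (Fin p)) : ℝ :=
  ⨆ n, maxGap (d n)

/-- `τ = inf_n τ_n`. -/
noncomputable def tau {p N : ℕ} (d : ℕ → Fin N → EuclideanSpace ℝ (Fin p)) : ℝ :=
  ⨅ n, minGap (d n)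

/-- The tail `∑_{i > n} s i`. -/
noncomputable def tailSum (s : ℕ → ℝ) (n : ℕ) : ℝ := ∑' i, s (n + 1 + i)

/-- The set of all sums `∑ i, s i • b i` with `b i` a digit of the `i`-th digit set.
(Sequences are indexed from `0` here: the entry with index `n` is the `(n + 1)`-st one.) -/
def sumSet {p N : ℕ} (s : ℕ → ℝ) (d : ℕ → Fin N → EuclideanSpace ℝ (Fin p)) :
    Set (EuclideanSpace ℝ (Fin p)) :=
  {x | ∃ b : ℕ → EuclideanSpace ℝ (Fin p),
    (∀ i, b i ∈ Set.range (d i)) ∧ HasSum (fun i => s i • b i) x}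

/-! The decay hypothesis says that the tail after a digit is dominated by the gap that this digit
creates. Hence the `N ^ (n + 1)` cylinders of level `n` have images of diameter at most a constant
times `s n` and pairwise distance at least another constant times `s n`
(`isSeparatedCoding_digitSum`). Both dimensions are then decided by comparing `N ^ (n + 1) * s n ^
t` with `1`, which amounts to comparing `t` with the rate in the statement.

Hausdorff: cylinders at infinitely many good levels give economical covers; conversely, decoding a
point and reading its digits in base `N` is a `t`-Hölder map onto `[0, 1]`. Packing: each small ball
contains a cylinder of comparable mass, so disjoint balls have bounded total
(`packingMeasure_range_ne_top`); conversely, some piece of any countable cover has positive mass, so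
it meets many cylinders and carries large packings (`packingMeasure_range_eq_top`). -/

open MeasureTheory ProbabilityTheory Set Topology

/-- The uniform product measure on the space of digit sequences. -/
noncomputable def uniformCodeMeasure (N : ℕ) [NeZero N] : Measure (ℕ → Fin N) :=
  Measure.infinitePi fun _ => uniformOn Set.univ

instance (N : ℕ) [NeZero N] : IsProbabilityMeasure (uniformCodeMeasure N) := by
  have : IsProbabilityMeasure (uniformOn (Set.univ : Set (Fin N))) :=
    isProbabilityMeasure_uniformOn Set.finite_univ Set.univ_nonempty
  unfold uniformCodeMeasure
  infer_instance

theorem cylinder_eq_pi {N : ℕ} (x : ℕ → Fin N) (k : ℕ) :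
    PiNat.cylinder x k = Set.pi (Finset.range k) fun i => {x i} := by
  ext y
  simp [PiNat.cylinder]

theorem measurableSet_codeCylinder {N : ℕ} (x : ℕ → Fin N) (k : ℕ) :
    MeasurableSet (PiNat.cylinder x k) := by
  rw [cylinder_eq_pi]
  exact MeasurableSet.pi (Finset.countable_toSet _) fun _ _ => measurableSet_singleton _

theorem uniformCodeMeasure_cylinder {N : ℕ} [NeZero N] (x : ℕ → Fin N) (k : ℕ) :
    uniformCodeMeasure N (PiNat.cylinder x k) = (N : ℝ≥0∞)⁻¹ ^ k := by
  have : IsProbabilityMeasure (uniformOn (Set.univ : Set (Fin N))) :=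
    isProbabilityMeasure_uniformOn Set.finite_univ Set.univ_nonempty
  rw [cylinder_eq_pi, uniformCodeMeasure, Measure.infinitePi_pi _ fun _ _ =>
    measurableSet_singleton _]
  simp [uniformOn_univ]

/-! ### Separated codings and Hausdorff dimension -/

/-- A map `π` from digit sequences to a metric space for which the images of the cylinders with
`k + 1` prescribed digits have diameter at most `A * s k` and are `c * s k`-separated. -/
structure IsSeparatedCoding {X : Type*} [MetricSpace X] {N : ℕ} (π : (ℕ → Fin N) → X)
    (s : ℕ → ℝ) (A c : ℝ) : Prop where
  scale_pos : ∀ n, 0 < s n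
  scale_antitone : Antitone s
  scale_tendsto : Tendsto s atTop (𝓝 0)
  diam_pos : 0 < A
  sep_pos : 0 < c
  dist_le : ∀ k x y, y ∈ PiNat.cylinder x (k + 1) → dist (π y) (π x) ≤ A * s k
  le_dist : ∀ k x y, y ∉ PiNat.cylinder x (k + 1) → c * s k ≤ dist (π y) (π x)

namespace IsSeparatedCoding

variable {X : Type*} [MetricSpace X] {N : ℕ} {π : (ℕ → Fin N) → X} {s : ℕ → ℝ} {A c : ℝ}

theorem le_dist_of_apply_ne (h : IsSeparatedCoding π s A c) {x y : ℕ → Fin N} {k : ℕ}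
    (hk : y k ≠ x k) : c * s k ≤ dist (π y) (π x) :=
  h.le_dist k x y fun hy => hk (hy k (Nat.lt_succ_self k))

theorem injective (h : IsSeparatedCoding π s A c) : Function.Injective π := by
  intro y x hxy
  by_contra hne
  obtain ⟨k, hk⟩ := Function.ne_iff.1 hne
  have := h.le_dist_of_apply_ne hk
  rw [hxy, dist_self] at this
  exact absurd this (not_le.2 (mul_pos h.sep_pos (h.scale_pos k)))

theorem dimH_range_le (h : IsSeparatedCoding π s A c) {t : ℝ≥0}
    (ht : ∃ᶠ n in atTop, (N : ℝ) ^ (n + 1) * s n ^ (t : ℝ) ≤ 1) : dimH (range π) ≤ t := by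
  borelize X
  set S := {n | (N : ℝ) ^ (n + 1) * s n ^ (t : ℝ) ≤ 1}
  have : (atTop ⊓ 𝓟 S).NeBot := frequently_mem_iff_neBot.1 ht
  set T : (n : ℕ) → (Fin (n + 1) → Fin N) → Set X :=
    fun n w => π '' {x | ∀ i : Fin (n + 1), x i = w i}
  have hT : ∀ n w, Metric.ediam (T n w) ≤ ENNReal.ofReal (A * s n) := by
    intro n w
    refine Metric.ediam_le ?_
    rintro _ ⟨y, hy, rfl⟩ _ ⟨x, hx, rfl⟩
    rw [edist_dist]
    refine ENNReal.ofReal_le_ofReal (h.dist_le n x y fun i hi => ?_)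
    rw [hy ⟨i, hi⟩, hx ⟨i, hi⟩]
  refine dimH_le_of_hausdorffMeasure_ne_top
    (ne_top_of_le_ne_top (ENNReal.ofReal_ne_top (r := A ^ (t : ℝ))) ?_)
  refine (Measure.hausdorffMeasure_le_liminf_sum (l := atTop ⊓ 𝓟 S) (t : ℝ) (range π)
    (fun n => ENNReal.ofReal (A * s n)) ?_ T (Eventually.of_forall hT)
    (Eventually.of_forall fun n => ?_)).trans ?_
  · have := ENNReal.tendsto_ofReal (h.scale_tendsto.const_mul A)
    rw [mul_zero, ENNReal.ofReal_zero] at this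
    exact this.mono_left inf_le_left
  · rintro _ ⟨x, rfl⟩
    exact mem_iUnion.2 ⟨fun i => x i, x, fun _ => rfl, rfl⟩
  · refine liminf_le_of_frequently_le' (Eventually.frequently ?_)
    refine mem_inf_of_right (mem_principal.2 fun n hn => ?_)
    calc ∑ w, Metric.ediam (T n w) ^ (t : ℝ)
        ≤ ∑ _w : Fin (n + 1) → Fin N, ENNReal.ofReal (A * s n) ^ (t : ℝ) :=
          Finset.sum_le_sum fun w _ => ENNReal.rpow_le_rpow (hT n w) t.coe_nonneg
      _ = ENNReal.ofReal (N ^ (n + 1) * (A * s n) ^ (t : ℝ)) := by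
          rw [Finset.sum_const, ENNReal.ofReal_mul (p := (N : ℝ) ^ (n + 1)) (by positivity),
            ENNReal.ofReal_pow (by positivity),
            ENNReal.ofReal_rpow_of_nonneg (mul_pos h.diam_pos (h.scale_pos n)).le t.coe_nonneg]
          simp
      _ ≤ ENNReal.ofReal (A ^ (t : ℝ)) := by
          refine ENNReal.ofReal_le_ofReal ?_
          rw [Real.mul_rpow h.diam_pos.le (h.scale_pos n).le, mul_left_comm]
          exact mul_le_of_le_one_right (Real.rpow_nonneg h.diam_pos.le _) hn

/-- The finitely many early levels, where the bound may fail, are absorbed into the constant because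
`s` is antitone. -/
theorem exists_inv_pow_le (h : IsSeparatedCoding π s A c) (hN : 2 ≤ N) {t : ℝ≥0}
    (ht : ∀ᶠ n in atTop, 1 ≤ (N : ℝ) ^ (n + 1) * s n ^ (t : ℝ)) :
    ∃ K : ℝ, 0 ≤ K ∧ ∀ k, ((N : ℝ) ^ (k + 1))⁻¹ ≤ K * s k ^ (t : ℝ) := by
  obtain ⟨m, hm⟩ := eventually_atTop.1 ht
  have hN' : (1 : ℝ) ≤ N := by exact_mod_cast (by omega : 1 ≤ N)
  have hs : ∀ k, 0 < s k ^ (t : ℝ) := fun k => Real.rpow_pos_of_pos (h.scale_pos k) _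
  refine ⟨1 + (s m ^ (t : ℝ))⁻¹, by have := hs m; positivity, fun k => ?_⟩
  have hpos : (0 : ℝ) < (N : ℝ) ^ (k + 1) := by positivity
  have h1 := hs m
  have h2 := hs k
  rw [add_mul, one_mul]
  rcases le_total m k with hmk | hkm
  · have : ((N : ℝ) ^ (k + 1))⁻¹ ≤ s k ^ (t : ℝ) := by
      rw [inv_le_iff_one_le_mul₀ hpos, mul_comm]
      exact hm k hmk
    have : 0 ≤ (s m ^ (t : ℝ))⁻¹ * s k ^ (t : ℝ) := by positivity
    linarith
  · have h3 : s m ^ (t : ℝ) ≤ s k ^ (t : ℝ) :=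
      Real.rpow_le_rpow (h.scale_pos m).le (h.scale_antitone hkm) t.coe_nonneg
    have h4 : ((N : ℝ) ^ (k + 1))⁻¹ ≤ 1 := inv_le_one_of_one_le₀ (one_le_pow₀ hN')
    have h5 : 1 ≤ (s m ^ (t : ℝ))⁻¹ * s k ^ (t : ℝ) := by
      rw [inv_mul_eq_div, one_le_div h1]
      exact h3
    linarith

/-- If two codes first differ at `k`, their base-`N` values are within `N⁻ᵏ`, which is at most a
constant times `s k ^ t`, while their images are at least `c * s k` apart. So the decoding map is
`t`-Hölder with image containing `[0, 1]`, and `1 ≤ dimH / t`. -/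
theorem le_dimH_range (h : IsSeparatedCoding π s A c) (hN : 2 ≤ N) {t : ℝ≥0} (ht0 : 0 < t)
    (ht : ∀ᶠ n in atTop, 1 ≤ (N : ℝ) ^ (n + 1) * s n ^ (t : ℝ)) : (t : ℝ≥0∞) ≤ dimH (range π) := by
  have : NeZero N := ⟨by omega⟩
  obtain ⟨K, hK0, hK⟩ := h.exists_inv_pow_le hN ht
  have hc := h.sep_pos
  have hct : 0 < c ^ (t : ℝ) := Real.rpow_pos_of_pos hc _
  set C : ℝ := N * K * (c ^ (t : ℝ))⁻¹
  have hC : 0 ≤ C := by positivity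
  have key : ∀ x y : ℕ → Fin N,
      dist (Real.ofDigits y) (Real.ofDigits x) ≤ C * dist (π y) (π x) ^ (t : ℝ) := by
    intro x y
    by_cases hxy : y = x
    · rw [hxy, dist_self]
      positivity
    set k := PiNat.firstDiff y x
    have h1 : c * s k ≤ dist (π y) (π x) :=
      h.le_dist_of_apply_ne (PiNat.apply_firstDiff_ne hxy)
    have h2 : dist (Real.ofDigits y) (Real.ofDigits x) ≤ ((N : ℝ) ^ k)⁻¹ :=
      Real.abs_ofDigits_sub_ofDigits_le fun i hi => PiNat.apply_eq_of_lt_firstDiff hi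
    have hN0 : (N : ℝ) ≠ 0 := NeZero.ne _
    calc dist (Real.ofDigits y) (Real.ofDigits x) ≤ ((N : ℝ) ^ k)⁻¹ := h2
      _ = N * ((N : ℝ) ^ (k + 1))⁻¹ := by rw [pow_succ]; field_simp
      _ ≤ N * (K * s k ^ (t : ℝ)) := by gcongr; exact hK k
      _ = C * (c * s k) ^ (t : ℝ) := by
          rw [Real.mul_rpow hc.le (h.scale_pos k).le]
          simp only [C]
          field_simp
      _ ≤ C * dist (π y) (π x) ^ (t : ℝ) := by
          gcongr
          exact (mul_pos hc (h.scale_pos k)).le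
  have hinv := Function.leftInverse_invFun h.injective
  have hold : HolderOnWith C.toNNReal t (fun z => Real.ofDigits (Function.invFun π z))
      (range π) := by
    rintro _ ⟨y, rfl⟩ _ ⟨x, rfl⟩
    simp only [hinv y, hinv x]
    rw [edist_dist, edist_dist, ENNReal.ofReal_rpow_of_nonneg dist_nonneg t.coe_nonneg,
      ← ENNReal.ofReal, ← ENNReal.ofReal_mul hC]
    exact ENNReal.ofReal_le_ofReal (key x y)
  have h1 : (1 : ℝ≥0∞) ≤ dimH (range π) / t := by
    refine le_trans ?_ (hold.dimH_image_le ht0)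
    have : Icc (0 : ℝ) 1 ⊆ (fun z => Real.ofDigits (Function.invFun π z)) '' range π := by
      intro r hr
      obtain ⟨x, -, hx⟩ := Real.ofDigits_SurjOn (b := N) (by omega) hr
      exact ⟨π x, mem_range_self x, by simp only [hinv x, hx]⟩
    refine le_trans ?_ (dimH_mono this)
    rw [Real.dimH_of_nonempty_interior (by simp)]
    simp
  rwa [ENNReal.le_div_iff_mul_le (Or.inl (by simpa using ht0.ne')) (Or.inl ENNReal.coe_ne_top),
    one_mul] at h1

end IsSeparatedCoding

/-! ### Packing measure and dimension -/

theorem packingPremeasure_empty {X : Type*} [MetricSpace X] (t : ℝ≥0) :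
    packingPremeasure t (∅ : Set X) = 0 := by
  refine le_antisymm ((iInf₂_le 1 one_pos).trans (iSup₂_le fun P hP => ?_)) zero_le
  have : IsEmpty P := ⟨fun b => (hP.1 b.1 b.2).1⟩
  simp

theorem packingMeasure_le_packingPremeasure {X : Type*} [MetricSpace X] (t : ℝ≥0) (E : Set X) :
    packingMeasure t E ≤ packingPremeasure t E := by
  refine (iInf₂_le (fun i : ℕ => if i = 0 then E else ∅)
    fun x hx => mem_iUnion.2 ⟨0, by simpa using hx⟩).trans ?_
  rw [tsum_eq_single 0]
  · simp
  · intro i hi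
    simp [hi, packingPremeasure_empty]

/-- Countable subadditivity leaves some piece of every cover with non-null preimage; the pieces need
not be measurable. -/
theorem packingMeasure_eq_top_of_premeasure {X Ω : Type*} [MetricSpace X] [MeasurableSpace Ω]
    (μ : Measure Ω) [NeZero μ] (π : Ω → X) {t : ℝ≥0}
    (h : ∀ E : Set X, μ (π ⁻¹' E) ≠ 0 → packingPremeasure t E = ∞) :
    packingMeasure t (range π) = ∞ := by
  refine iInf₂_eq_top.2 fun F hF => ?_
  obtain ⟨i, hi⟩ : ∃ i, μ (π ⁻¹' F i) ≠ 0 := by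
    by_contra! hzero
    have huniv : (univ : Set Ω) ⊆ ⋃ i, π ⁻¹' F i := fun x _ => by
      simpa using hF (mem_range_self x)
    exact NeZero.ne μ (Measure.measure_univ_eq_zero.1
      (measure_mono_null huniv (measure_iUnion_null hzero)))
  exact ENNReal.tsum_eq_top_of_eq_top ⟨i, h _ hi⟩

theorem dimP_le {X : Type*} [MetricSpace X] {E : Set X} {a : ℝ≥0∞}
    (h : ∀ t : ℝ≥0, packingMeasure t E = ∞ → (t : ℝ≥0∞) ≤ a) : dimP E ≤ a :=
  iSup₂_le h

theorem le_dimP {X : Type*} [MetricSpace X] {E : Set X} {t : ℝ≥0}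
    (h : packingMeasure t E = ∞) : (t : ℝ≥0∞) ≤ dimP E :=
  le_iSup₂ (f := fun (t : ℝ≥0) (_ : packingMeasure t E = ∞) => (t : ℝ≥0∞)) t h

theorem tsum_uniformCodeMeasure_le_one {N : ℕ} [NeZero N] {ι : Type*} (x : ι → ℕ → Fin N)
    (k : ι → ℕ) (h : Pairwise (Function.onFun Disjoint fun i => PiNat.cylinder (x i) (k i))) :
    ∑' i, (N : ℝ≥0∞)⁻¹ ^ k i ≤ 1 := by
  have := tsum_measure_le_measure_univ (μ := uniformCodeMeasure N)
    (fun i => (measurableSet_codeCylinder (x i) (k i)).nullMeasurableSet)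
    (fun i j hij => (h hij).aedisjoint)
  simpa only [uniformCodeMeasure_cylinder, measure_univ] using this

namespace IsSeparatedCoding

variable {X : Type*} [MetricSpace X] {N : ℕ} {π : (ℕ → Fin N) → X} {s : ℕ → ℝ} {A c : ℝ}

/-- A small ball centred on the coded set contains a cylinder whose mass controls the diameter
of the ball. -/
theorem exists_cylinder_subset_ball (h : IsSeparatedCoding π s A c) [NeZero N] {t : ℝ≥0} {m : ℕ}
    (hm : ∀ n ≥ m, (N : ℝ) ^ (n + 1) * s n ^ (t : ℝ) ≤ 1) (x : ℕ → Fin N) {r : ℝ} (hr : 0 < r)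
    (hrm : r ≤ A * s m) :
    ∃ k, PiNat.cylinder x k ⊆ π ⁻¹' Metric.ball (π x) r ∧
      Metric.ediam (Metric.ball (π x) r) ^ (t : ℝ) ≤
        ENNReal.ofReal ((2 * A) ^ (t : ℝ) * N) * (N : ℝ≥0∞)⁻¹ ^ k := by
  have hA := h.diam_pos
  have hex : ∃ j, A * s j < r := by
    have := h.scale_tendsto.const_mul A
    rw [mul_zero] at this
    exact (this.eventually_lt_const hr).exists
  -- With `j` least, the cylinder of `j + 1` digits fits in the ball, while the previous scale still
  -- bounds `r` from above. The bound on `r` forces `j > m`, so that the previous index is at least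
  -- `m`.
  obtain ⟨j, hj, hjmin⟩ : ∃ j, A * s j < r ∧ ∀ i < j, r ≤ A * s i := by
    classical
    exact ⟨Nat.find hex, Nat.find_spec hex, fun i hi => not_lt.1 (Nat.find_min hex hi)⟩
  have hmj : m < j := by
    by_contra! hjm
    have := mul_le_mul_of_nonneg_left (h.scale_antitone hjm) hA.le
    linarith
  obtain ⟨i, rfl⟩ : ∃ i, j = i + 1 := ⟨j - 1, by omega⟩
  refine ⟨i + 1 + 1, fun y hy => (h.dist_le _ x y hy).trans_lt hj, ?_⟩
  have hN : (0 : ℝ) < N := by exact_mod_cast NeZero.pos N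
  have hi := h.scale_pos i
  have hdiam : Metric.ediam (Metric.ball (π x) r) ≤ ENNReal.ofReal (2 * A * s i) := by
    refine Metric.ediam_le fun y hy z hz => ?_
    rw [edist_dist]
    refine ENNReal.ofReal_le_ofReal ?_
    have h1 := dist_triangle_right y z (π x)
    have h2 := hjmin i (Nat.lt_succ_self i)
    rw [Metric.mem_ball] at hy hz
    linarith
  have hle : s i ^ (t : ℝ) ≤ ((N : ℝ) ^ (i + 1))⁻¹ := by
    rw [← one_div, le_div_iff₀' (by positivity)]
    exact hm i (by omega)
  calc Metric.ediam (Metric.ball (π x) r) ^ (t : ℝ)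
      ≤ ENNReal.ofReal (2 * A * s i) ^ (t : ℝ) := ENNReal.rpow_le_rpow hdiam t.coe_nonneg
    _ = ENNReal.ofReal ((2 * A) ^ (t : ℝ) * s i ^ (t : ℝ)) := by
        rw [ENNReal.ofReal_rpow_of_nonneg (by positivity) t.coe_nonneg,
          Real.mul_rpow (by positivity) hi.le]
    _ ≤ ENNReal.ofReal ((2 * A) ^ (t : ℝ) * N * ((N : ℝ)⁻¹) ^ (i + 1 + 1)) := by
        refine ENNReal.ofReal_le_ofReal ?_
        have : (N : ℝ) * ((N : ℝ)⁻¹) ^ (i + 1 + 1) = ((N : ℝ) ^ (i + 1))⁻¹ := by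
          rw [pow_succ (N : ℝ)⁻¹, inv_pow]
          field_simp
        rw [mul_assoc, this]
        gcongr
    _ = ENNReal.ofReal ((2 * A) ^ (t : ℝ) * N) * (N : ℝ≥0∞)⁻¹ ^ (i + 1 + 1) := by
        rw [ENNReal.ofReal_mul (by positivity), ENNReal.ofReal_pow (by positivity),
          ENNReal.ofReal_inv_of_pos hN, ENNReal.ofReal_natCast]

theorem packingMeasure_range_ne_top (h : IsSeparatedCoding π s A c) [NeZero N] {t : ℝ≥0}
    (ht : ∀ᶠ n in atTop, (N : ℝ) ^ (n + 1) * s n ^ (t : ℝ) ≤ 1) :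
    packingMeasure t (range π) ≠ ∞ := by
  obtain ⟨m, hm⟩ := eventually_atTop.1 ht
  refine ne_top_of_le_ne_top (ENNReal.ofReal_ne_top (r := (2 * A) ^ (t : ℝ) * N))
    ((packingMeasure_le_packingPremeasure t _).trans
      ((iInf₂_le (A * s m) (mul_pos h.diam_pos (h.scale_pos m))).trans
        (iSup₂_le fun P hP => ?_)))
  have hball : ∀ b : P, ∃ (x : ℕ → Fin N) (k : ℕ),
      PiNat.cylinder x k ⊆ π ⁻¹' Metric.ball b.1.1 b.1.2 ∧
      Metric.ediam (Metric.ball b.1.1 b.1.2) ^ (t : ℝ) ≤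
        ENNReal.ofReal ((2 * A) ^ (t : ℝ) * N) * (N : ℝ≥0∞)⁻¹ ^ k := by
    rintro ⟨⟨z, r⟩, hb⟩
    obtain ⟨⟨x, rfl⟩, hr, hrm⟩ := hP.1 _ hb
    exact ⟨x, h.exists_cylinder_subset_ball hm x hr hrm⟩
  choose x k hsub hle using hball
  calc ∑' b : P, Metric.ediam (Metric.ball b.1.1 b.1.2) ^ (t : ℝ)
      ≤ ∑' b : P, ENNReal.ofReal ((2 * A) ^ (t : ℝ) * N) * (N : ℝ≥0∞)⁻¹ ^ k b :=
        ENNReal.tsum_le_tsum hle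
    _ = ENNReal.ofReal ((2 * A) ^ (t : ℝ) * N) * ∑' b : P, (N : ℝ≥0∞)⁻¹ ^ k b :=
        ENNReal.tsum_mul_left
    _ ≤ ENNReal.ofReal ((2 * A) ^ (t : ℝ) * N) * 1 := by
        gcongr
        refine tsum_uniformCodeMeasure_le_one x k fun b b' hbb' => ?_
        exact Disjoint.mono (hsub b) (hsub b')
          ((hP.2 b.2 b'.2 fun hne => hbb' (Subtype.ext hne)).preimage π)
    _ = _ := mul_one _

/-- Choosing one point of `E` in each level-`n` cylinder that meets `E` gives a packing. -/
theorem measure_preimage_mul_le_packingSup (h : IsSeparatedCoding π s A c) [NeZero N]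
    (hball : ∀ (z : X) (r : ℝ), 0 < r → ENNReal.ofReal r ≤ Metric.ediam (Metric.ball z r))
    (t : ℝ≥0) (E : Set X) {n : ℕ} {δ : ℝ} (hn : c / 2 * s n ≤ δ) :
    uniformCodeMeasure N (π ⁻¹' E) *
      ENNReal.ofReal ((N : ℝ) ^ (n + 1) * (c / 2 * s n) ^ (t : ℝ)) ≤ packingSup t δ E := by
  classical
  set F : Set (Fin (n + 1) → Fin N) := {w | ∃ x, π x ∈ E ∧ ∀ i : Fin (n + 1), x i = w i}
  -- Half the separation as radius makes the balls disjoint.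
  have hr : 0 < c / 2 * s n := mul_pos (half_pos h.sep_pos) (h.scale_pos n)
  choose x hxE hxw using fun w : F => w.2
  have hsep : ∀ w w' : F, w ≠ w' → 2 * (c / 2 * s n) ≤ dist (π (x w)) (π (x w')) := by
    intro w w' hne
    have : x w ∉ PiNat.cylinder (x w') (n + 1) := fun hmem => hne (Subtype.ext (funext fun i => by
      rw [← hxw w i, ← hxw w' i]
      exact hmem i i.2))
    have := h.le_dist n _ _ this
    linarith
  set g : F → X × ℝ := fun w => (π (x w), c / 2 * s n) with hg
  have hginj : Function.Injective g := fun w w' hww' => by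
    by_contra hne
    have h1 := hsep w w' hne
    rw [show π (x w) = π (x w') from congrArg Prod.fst hww', dist_self] at h1
    linarith
  have hpack : IsPacking δ E (range g) := by
    refine ⟨?_, ?_⟩
    · rintro _ ⟨w, rfl⟩
      exact ⟨hxE w, hr, hn⟩
    · rintro _ ⟨w, rfl⟩ _ ⟨w', rfl⟩ hne
      refine Metric.ball_disjoint_ball ?_
      have := hsep w w' fun hww' => hne (by rw [hww'])
      simp only [hg]
      linarith
  have hμ : uniformCodeMeasure N (π ⁻¹' E) ≤ Nat.card F * (N : ℝ≥0∞)⁻¹ ^ (n + 1) := by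
    have hcover : π ⁻¹' E ⊆ ⋃ w : F, PiNat.cylinder (x w) (n + 1) := by
      intro y hy
      let w : F := ⟨fun i => y i, y, hy, fun _ => rfl⟩
      exact mem_iUnion.2 ⟨w, fun i hi => (hxw w ⟨i, hi⟩).symm⟩
    refine (measure_mono hcover).trans ((measure_iUnion_le _).trans ?_)
    simp only [uniformCodeMeasure_cylinder]
    rw [tsum_fintype, Finset.sum_const, Finset.card_univ, Nat.card_eq_fintype_card, nsmul_eq_mul]
  have hN0 : (N : ℝ≥0∞) ≠ 0 := by exact_mod_cast NeZero.ne N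
  calc uniformCodeMeasure N (π ⁻¹' E) *
        ENNReal.ofReal ((N : ℝ) ^ (n + 1) * (c / 2 * s n) ^ (t : ℝ))
      ≤ (Nat.card F * (N : ℝ≥0∞)⁻¹ ^ (n + 1)) *
        ENNReal.ofReal ((N : ℝ) ^ (n + 1) * (c / 2 * s n) ^ (t : ℝ)) := by gcongr
    _ = Nat.card F * ENNReal.ofReal (c / 2 * s n) ^ (t : ℝ) := by
        rw [ENNReal.ofReal_mul (by positivity), ENNReal.ofReal_pow (by positivity),
          ENNReal.ofReal_natCast, ENNReal.ofReal_rpow_of_nonneg hr.le t.coe_nonneg, mul_assoc,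
          ← mul_assoc ((N : ℝ≥0∞)⁻¹ ^ (n + 1)), ← mul_pow,
          ENNReal.inv_mul_cancel hN0 (ENNReal.natCast_ne_top N), one_pow, one_mul]
    _ = ∑' _w : F, ENNReal.ofReal (c / 2 * s n) ^ (t : ℝ) := by
        rw [tsum_fintype, Finset.sum_const, Finset.card_univ, Nat.card_eq_fintype_card,
          nsmul_eq_mul]
    _ ≤ ∑' w : F, Metric.ediam (Metric.ball (g w).1 (g w).2) ^ (t : ℝ) :=
        ENNReal.tsum_le_tsum fun w => ENNReal.rpow_le_rpow (hball _ _ hr) t.coe_nonneg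
    _ = ∑' b : range g, Metric.ediam (Metric.ball b.1.1 b.1.2) ^ (t : ℝ) :=
        (tsum_range (fun b : X × ℝ => Metric.ediam (Metric.ball b.1 b.2) ^ (t : ℝ)) hginj).symm
    _ ≤ packingSup t δ E :=
        le_iSup₂ (f := fun (P : Set (X × ℝ)) (_ : IsPacking δ E P) =>
          ∑' b : P, Metric.ediam (Metric.ball b.1.1 b.1.2) ^ (t : ℝ)) (range g) hpack

/-- At the good levels for `u`, `N ^ (n + 1) * s n ^ t` is at least `s n ^ (-(u - t))`, which tends
to infinity and so beats any fixed positive mass. -/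
theorem packingMeasure_range_eq_top (h : IsSeparatedCoding π s A c) [NeZero N]
    (hball : ∀ (z : X) (r : ℝ), 0 < r → ENNReal.ofReal r ≤ Metric.ediam (Metric.ball z r))
    {t u : ℝ≥0} (htu : t < u)
    (hu : ∃ᶠ n in atTop, 1 ≤ (N : ℝ) ^ (n + 1) * s n ^ (u : ℝ)) :
    packingMeasure t (range π) = ∞ := by
  refine packingMeasure_eq_top_of_premeasure (uniformCodeMeasure N) π fun E hE => ?_
  refine iInf₂_eq_top.2 fun δ hδ => ?_
  have hc2 : 0 < c / 2 := half_pos h.sep_pos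
  have hsmall : ∀ᶠ n in atTop, c / 2 * s n ≤ δ := by
    have := h.scale_tendsto.const_mul (c / 2)
    rw [mul_zero] at this
    exact this.eventually_le_const hδ
  have hlim : Tendsto (fun n => (c / 2) ^ (t : ℝ) * s n ^ (-((u : ℝ) - t))) atTop atTop := by
    refine Tendsto.const_mul_atTop (Real.rpow_pos_of_pos hc2 _) ?_
    have hs0 : Tendsto s atTop (𝓝[>] 0) :=
      tendsto_nhdsWithin_iff.2 ⟨h.scale_tendsto, Eventually.of_forall h.scale_pos⟩
    exact (tendsto_rpow_neg_nhdsGT_zero (by simpa using htu)).comp hs0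
  refine ENNReal.eq_top_of_forall_nnreal_le fun K => ?_
  have hμtop : uniformCodeMeasure N (π ⁻¹' E) ≠ ∞ := measure_ne_top _ _
  have hμpos := ENNReal.toReal_pos hE hμtop
  obtain ⟨n, hn, hnδ, hnK⟩ := (hu.and_eventually
    (hsmall.and (hlim.eventually_ge_atTop (K / (uniformCodeMeasure N (π ⁻¹' E)).toReal)))).exists
  refine le_trans ?_ (h.measure_preimage_mul_le_packingSup hball t E hnδ)
  have hsn := h.scale_pos n
  have hbig : (c / 2) ^ (t : ℝ) * s n ^ (-((u : ℝ) - t)) ≤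
      (N : ℝ) ^ (n + 1) * (c / 2 * s n) ^ (t : ℝ) := by
    rw [Real.mul_rpow hc2.le hsn.le, show -((u : ℝ) - t) = t - u by ring,
      Real.rpow_sub hsn, mul_left_comm]
    refine mul_le_mul_of_nonneg_left ?_ (Real.rpow_nonneg hc2.le _)
    rw [div_le_iff₀ (Real.rpow_pos_of_pos hsn _)]
    nlinarith [Real.rpow_pos_of_pos hsn t]
  rw [← ENNReal.ofReal_toReal hμtop, ← ENNReal.ofReal_mul hμpos.le, ← ENNReal.ofReal_coe_nnreal]
  refine ENNReal.ofReal_le_ofReal ?_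
  have := hnK.trans hbig
  rwa [div_le_iff₀' hμpos] at this

end IsSeparatedCoding

/-! ### From scale inequalities to the rates -/

section ScalesAndRates

variable {N : ℕ} {x : ℝ} (n : ℕ) (t : ℝ)

theorem pow_mul_rpow_eq_exp (hN : 2 ≤ N) (hx0 : 0 < x) :
    (N : ℝ) ^ (n + 1) * x ^ t = Real.exp (((n : ℝ) + 1) * Real.log N + t * Real.log x) := by
  have hN0 : (0 : ℝ) < N := by exact_mod_cast (by omega : 0 < N)
  rw [Real.exp_add, Real.rpow_def_of_pos hx0, mul_comm t, mul_comm ((n : ℝ) + 1),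
    ← Nat.cast_add_one, ← Real.rpow_def_of_pos hN0, Real.rpow_natCast]

theorem pow_mul_rpow_le_one_iff (hN : 2 ≤ N) (hx0 : 0 < x) (hx1 : x < 1) :
    (N : ℝ) ^ (n + 1) * x ^ t ≤ 1 ↔ -((n : ℝ) + 1) * Real.log N / Real.log x ≤ t := by
  rw [pow_mul_rpow_eq_exp n t hN hx0, Real.exp_le_one_iff,
    div_le_iff_of_neg (Real.log_neg hx0 hx1)]
  constructor <;> intro h <;> linarith

theorem one_le_pow_mul_rpow_iff (hN : 2 ≤ N) (hx0 : 0 < x) (hx1 : x < 1) :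
    1 ≤ (N : ℝ) ^ (n + 1) * x ^ t ↔ t ≤ -((n : ℝ) + 1) * Real.log N / Real.log x := by
  rw [pow_mul_rpow_eq_exp n t hN hx0, Real.one_le_exp_iff,
    le_div_iff_of_neg (Real.log_neg hx0 hx1)]
  constructor <;> intro h <;> linarith

theorem rate_nonneg (hN : 2 ≤ N) (hx0 : 0 < x) (hx1 : x < 1) :
    0 ≤ -((n : ℝ) + 1) * Real.log N / Real.log x := by
  have hN1 : (1 : ℝ) ≤ N := by exact_mod_cast (by omega : 1 ≤ N)
  refine div_nonneg_of_nonpos ?_ (Real.log_neg hx0 hx1).le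
  have := Real.log_nonneg hN1
  have : (0 : ℝ) ≤ (n : ℝ) + 1 := by positivity
  nlinarith

end ScalesAndRates

theorem ereal_coe_ennreal_eq_of_forall {a : ℝ≥0∞} {b : EReal} (hb : 0 ≤ b)
    (hle : ∀ t : ℝ≥0, b < ((t : ℝ) : EReal) → a ≤ t)
    (hge : ∀ t : ℝ≥0, 0 < t → ((t : ℝ) : EReal) < b → (t : ℝ≥0∞) ≤ a) : (a : EReal) = b := by
  have hcoe : ∀ t : ℝ≥0, (((t : ℝ≥0∞)) : EReal) = ((t : ℝ) : EReal) := fun t => rfl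
  refine le_antisymm (EReal.le_of_forall_lt_iff_le.1 fun z hz => ?_)
    (EReal.ge_of_forall_gt_iff_ge.1 fun z hz => ?_)
  · have hz0 : 0 ≤ z := by exact_mod_cast (hb.trans hz.le)
    lift z to ℝ≥0 using hz0
    rw [← hcoe]
    exact_mod_cast hle z hz
  · rcases le_or_gt z 0 with hz0 | hz0
    · exact le_trans (by exact_mod_cast hz0) (EReal.coe_ennreal_nonneg a)
    · lift z to ℝ≥0 using hz0.le
      rw [← hcoe]
      exact_mod_cast hge z (by exact_mod_cast hz0) hz

namespace IsSeparatedCoding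

variable {X : Type*} [MetricSpace X] {N : ℕ} {π : (ℕ → Fin N) → X} {s : ℕ → ℝ} {A c : ℝ}

theorem eventually_scale_lt_one (h : IsSeparatedCoding π s A c) : ∀ᶠ n in atTop, s n < 1 :=
  h.scale_tendsto.eventually_lt_const one_pos

theorem dimH_range_eq (h : IsSeparatedCoding π s A c) (hN : 2 ≤ N) :
    ((dimH (range π) : ℝ≥0∞) : EReal) =
      liminf (fun n : ℕ => ((-((n : ℝ) + 1) * Real.log N / Real.log (s n) : ℝ) : EReal)) atTop := by
  refine ereal_coe_ennreal_eq_of_forall ?_ (fun t ht => ?_) fun t ht0 ht => ?_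
  · refine le_liminf_of_le (by isBoundedDefault) ?_
    filter_upwards [h.eventually_scale_lt_one] with n hn
    exact_mod_cast rate_nonneg n hN (h.scale_pos n) hn
  · refine h.dimH_range_le
      (((frequently_lt_of_liminf_lt (by isBoundedDefault) ht).and_eventually
        h.eventually_scale_lt_one).mono fun n hn => ?_)
    exact (pow_mul_rpow_le_one_iff n t hN (h.scale_pos n) hn.2).2
      (EReal.coe_le_coe_iff.1 hn.1.le)
  · refine h.le_dimH_range hN ht0 ?_
    filter_upwards [eventually_lt_of_lt_liminf ht, h.eventually_scale_lt_one] with n hn hn1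
    exact (one_le_pow_mul_rpow_iff n t hN (h.scale_pos n) hn1).2
      (EReal.coe_le_coe_iff.1 hn.le)

theorem dimP_range_eq (h : IsSeparatedCoding π s A c) (hN : 2 ≤ N)
    (hball : ∀ (z : X) (r : ℝ), 0 < r → ENNReal.ofReal r ≤ Metric.ediam (Metric.ball z r)) :
    ((dimP (range π) : ℝ≥0∞) : EReal) =
      limsup (fun n : ℕ => ((-((n : ℝ) + 1) * Real.log N / Real.log (s n) : ℝ) : EReal)) atTop := by
  have : NeZero N := ⟨by omega⟩
  refine ereal_coe_ennreal_eq_of_forall ?_ (fun t ht => ?_) fun t ht0 ht => ?_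
  · refine le_limsup_of_frequently_le (Eventually.frequently ?_) (by isBoundedDefault)
    filter_upwards [h.eventually_scale_lt_one] with n hn
    exact_mod_cast rate_nonneg n hN (h.scale_pos n) hn
  · refine dimP_le fun u hu => ?_
    by_contra! htu
    refine h.packingMeasure_range_ne_top (t := u) ?_ hu
    have hut : ((t : ℝ) : EReal) < ((u : ℝ) : EReal) := by exact_mod_cast htu
    filter_upwards [eventually_lt_of_limsup_lt (ht.trans hut), h.eventually_scale_lt_one]
      with n hn hn1
    exact (pow_mul_rpow_le_one_iff n u hN (h.scale_pos n) hn1).2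
      (EReal.coe_le_coe_iff.1 hn.le)
  · obtain ⟨v, htv, hv⟩ := EReal.lt_iff_exists_real_btwn.1 ht
    have hv0 : 0 ≤ v := t.coe_nonneg.trans (EReal.coe_lt_coe_iff.1 htv).le
    lift v to ℝ≥0 using hv0
    refine le_dimP (h.packingMeasure_range_eq_top hball
      (u := v) (by exact_mod_cast htv) ?_)
    refine ((frequently_lt_of_lt_limsup (by isBoundedDefault) hv).and_eventually
        h.eventually_scale_lt_one).mono fun n hn => ?_
    exact (one_le_pow_mul_rpow_iff n v hN (h.scale_pos n) hn.2).2
      (EReal.coe_le_coe_iff.1 hn.1.le)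

end IsSeparatedCoding

/-! ### The digit sums form a separated coding -/

section Digits

variable {p N : ℕ}

theorem norm_sub_le_maxGap (e : Fin N → EuclideanSpace ℝ (Fin p)) {i j : Fin N} (hij : i ≠ j) :
    ‖e i - e j‖ ≤ maxGap e :=
  le_ciSup (f := fun q : {q : Fin N × Fin N // q.1 ≠ q.2} => ‖e q.1.1 - e q.1.2‖)
    (Set.finite_range _).bddAbove ⟨(i, j), hij⟩

theorem minGap_le_norm_sub (e : Fin N → EuclideanSpace ℝ (Fin p)) {i j : Fin N} (hij : i ≠ j) :
    minGap e ≤ ‖e i - e j‖ :=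
  ciInf_le (f := fun q : {q : Fin N × Fin N // q.1 ≠ q.2} => ‖e q.1.1 - e q.1.2‖)
    (Set.finite_range _).bddBelow ⟨(i, j), hij⟩

theorem tau_le_norm_sub (d : ℕ → Fin N → EuclideanSpace ℝ (Fin p)) (n : ℕ) {i j : Fin N}
    (hij : i ≠ j) : tau d ≤ ‖d n i - d n j‖ := by
  refine (ciInf_le ⟨0, ?_⟩ n).trans (minGap_le_norm_sub (d n) hij)
  rintro _ ⟨k, rfl⟩
  exact Real.iInf_nonneg fun _ => norm_nonneg _

theorem norm_sub_le_kappa {d : ℕ → Fin N → EuclideanSpace ℝ (Fin p)}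
    (hd : BddAbove (range fun n => maxGap (d n))) (n : ℕ) {i j : Fin N} (hij : i ≠ j) :
    ‖d n i - d n j‖ ≤ kappa d :=
  (norm_sub_le_maxGap (d n) hij).trans (le_ciSup hd n)

/-- The coding map sending a sequence of digit indices to the corresponding sum. -/
noncomputable def digitSum (s : ℕ → ℝ) (d : ℕ → Fin N → EuclideanSpace ℝ (Fin p))
    (x : ℕ → Fin N) : EuclideanSpace ℝ (Fin p) :=
  ∑' i, s i • d i (x i)

variable {s : ℕ → ℝ} {d : ℕ → Fin N → EuclideanSpace ℝ (Fin p)}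

theorem norm_digit_sub_le (hκ : BddAbove (range fun n => maxGap (d n))) (hκ0 : 0 ≤ kappa d)
    (n : ℕ) (i j : Fin N) : ‖d n i - d n j‖ ≤ kappa d := by
  by_cases hij : i = j
  · simpa [hij] using hκ0
  · exact norm_sub_le_kappa hκ n hij

theorem norm_smul_le_kappa_mul (hs : ∀ n, 0 < s n) {n : ℕ} {v : EuclideanSpace ℝ (Fin p)}
    (hv : ‖v‖ ≤ kappa d) : ‖s n • v‖ ≤ kappa d * s n := by
  rw [norm_smul, Real.norm_of_nonneg (hs n).le, mul_comm]
  exact mul_le_mul_of_nonneg_right hv (hs n).le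

theorem summable_smul_digit (hs : ∀ n, 0 < s n) (hsum : Summable s)
    (hzero : ∀ n, (0 : EuclideanSpace ℝ (Fin p)) ∈ range (d n))
    (hκ : BddAbove (range fun n => maxGap (d n))) (hκ0 : 0 ≤ kappa d) (x : ℕ → Fin N) :
    Summable fun i => s i • d i (x i) := by
  refine Summable.of_norm_bounded (hsum.mul_left (kappa d)) fun i => norm_smul_le_kappa_mul hs ?_
  -- As `0` is a digit, `kappa d` bounds the digits themselves and not only their differences.
  obtain ⟨j, hj⟩ := hzero i
  simpa [hj] using norm_digit_sub_le hκ hκ0 i (x i) j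

theorem range_digitSum (hsummable : ∀ x : ℕ → Fin N, Summable fun i => s i • d i (x i)) :
    range (digitSum s d) = sumSet s d := by
  ext z
  constructor
  · rintro ⟨x, rfl⟩
    exact ⟨fun i => d i (x i), fun i => mem_range_self _, (hsummable x).hasSum⟩
  · rintro ⟨b, hb, hz⟩
    choose x hx using hb
    refine ⟨x, ?_⟩
    rw [digitSum]
    simp only [hx]
    exact hz.tsum_eq

/-- After a common prefix of length `k`, the difference of two sums is its leading term up to an
error controlled by the tail. -/
theorem norm_digitSum_sub_sub_le (hs : ∀ n, 0 < s n) (hsum : Summable s)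
    (hκ : BddAbove (range fun n => maxGap (d n))) (hκ0 : 0 ≤ kappa d)
    (hsummable : ∀ x : ℕ → Fin N, Summable fun i => s i • d i (x i))
    {x y : ℕ → Fin N} {k : ℕ} (hxy : ∀ i < k, y i = x i) :
    ‖digitSum s d y - digitSum s d x - s k • (d k (y k) - d k (x k))‖ ≤
      kappa d * tailSum s k := by
  set f : ℕ → EuclideanSpace ℝ (Fin p) := fun i => s i • (d i (y i) - d i (x i)) with hf
  have hfs : Summable f := by
    simpa only [hf, smul_sub] using (hsummable y).sub (hsummable x)
  have h1 : digitSum s d y - digitSum s d x = ∑' i, f i := by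
    rw [digitSum, digitSum, ← (hsummable y).tsum_sub (hsummable x)]
    simp only [hf, smul_sub]
  have h2 : ∑ i ∈ Finset.range (k + 1), f i = s k • (d k (y k) - d k (x k)) := by
    rw [Finset.sum_range_succ, Finset.sum_eq_zero, zero_add]
    intro i hi
    simp [hf, hxy i (Finset.mem_range.1 hi)]
  rw [h1, ← hfs.sum_add_tsum_nat_add (k + 1), h2, add_sub_cancel_left, tailSum, ← tsum_mul_left]
  have hcomm : ∀ i, i + (k + 1) = k + 1 + i := fun i => add_comm _ _
  simp only [hcomm]
  refine tsum_of_norm_bounded (Summable.hasSum ?_) fun i =>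
    norm_smul_le_kappa_mul hs (norm_digit_sub_le hκ hκ0 _ _ _)
  have := (summable_nat_add_iff (k + 1)).2 hsum
  simp only [hcomm] at this
  exact this.mul_left _

theorem succ_le_tailSum (hs : ∀ n, 0 < s n) (hsum : Summable s) (n : ℕ) :
    s (n + 1) ≤ tailSum s n := by
  have : Summable fun i => s (n + 1 + i) := by
    simpa only [add_comm] using (summable_nat_add_iff (n + 1)).2 hsum
  exact this.le_tsum 0 fun j _ => (hs _).le

theorem isSeparatedCoding_digitSum (hN : 2 ≤ N) (hs : ∀ n, 0 < s n) (hsum : Summable s)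
    (hκ : BddAbove (range fun n => maxGap (d n))) (hτ : 0 < tau d)
    (hsummable : ∀ x : ℕ → Fin N, Summable fun i => s i • d i (x i))
    {M : ℝ} (hM : M < 1) (hdecay : ∀ n, kappa d * tailSum s n / (tau d * s n) ≤ M) :
    IsSeparatedCoding (digitSum s d) s (tau d) ((1 - M) * tau d) := by
  have h01 : (⟨0, by omega⟩ : Fin N) ≠ ⟨1, by omega⟩ := by simp
  have hτκ : tau d ≤ kappa d := (tau_le_norm_sub d 0 h01).trans (norm_sub_le_kappa hκ 0 h01)
  have hκ0 : 0 < kappa d := hτ.trans_le hτκ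
  have htail : ∀ n, kappa d * tailSum s n ≤ M * (tau d * s n) := fun n =>
    (div_le_iff₀ (mul_pos hτ (hs n))).1 (hdecay n)
  have hle : ∀ n, M * (tau d * s n) ≤ tau d * s n := fun n =>
    mul_le_of_le_one_left (mul_pos hτ (hs n)).le hM.le
  -- `κ s_{n+1} ≤ κ R_n ≤ τ s_n ≤ κ s_n`.
  have hanti : Antitone s := antitone_nat_of_succ_le fun n => by
    refine (succ_le_tailSum hs hsum n).trans (le_of_mul_le_mul_left ?_ hκ0)
    exact ((htail n).trans (hle n)).trans (mul_le_mul_of_nonneg_right hτκ (hs n).le)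
  refine ⟨hs, hanti, hsum.tendsto_atTop_zero, hτ, mul_pos (by linarith) hτ, ?_, ?_⟩
  · intro k x y hy
    have := norm_digitSum_sub_sub_le hs hsum hκ hκ0.le hsummable (x := x) (y := y) (k := k)
      fun i hi => hy i (hi.trans (Nat.lt_succ_self k))
    rw [hy k (Nat.lt_succ_self k), sub_self, smul_zero, sub_zero] at this
    rw [dist_eq_norm]
    exact this.trans ((htail k).trans (hle k))
  · intro k x y hy
    have hne : y ≠ x := fun h => hy (h ▸ PiNat.self_mem_cylinder x (k + 1))
    -- At the first difference the leading term has norm at least `τ s_j` and the tail takes away at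
    -- most `M τ s_j`; then `s j ≥ s k`.
    set j := PiNat.firstDiff y x
    have hjk : j ≤ k := by
      by_contra! hkj
      exact hy fun i hi => PiNat.apply_eq_of_lt_firstDiff (by omega)
    have h1 := norm_digitSum_sub_sub_le hs hsum hκ hκ0.le hsummable (x := x) (y := y) (k := j)
      fun i hi => PiNat.apply_eq_of_lt_firstDiff hi
    have h2 : tau d * s j ≤ ‖s j • (d j (y j) - d j (x j))‖ := by
      rw [norm_smul, Real.norm_of_nonneg (hs j).le, mul_comm]
      exact mul_le_mul_of_nonneg_left
        (tau_le_norm_sub d j (PiNat.apply_firstDiff_ne hne)) (hs j).le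
    have h3 := norm_sub_norm_le (s j • (d j (y j) - d j (x j)))
      (digitSum s d y - digitSum s d x)
    rw [norm_sub_rev (s j • (d j (y j) - d j (x j)))] at h3
    have h4 : (1 - M) * tau d * s k ≤ (1 - M) * tau d * s j :=
      mul_le_mul_of_nonneg_left (hanti hjk) (mul_pos (by linarith) hτ).le
    have h5 := htail j
    rw [dist_eq_norm]
    linarith

end Digits

/-- The diameter is in fact `2 * r`; nontriviality excludes the one-point space, whose balls have
diameter `0`. -/
theorem ofReal_le_ediam_ball {E : Type*} [NormedAddCommGroup E] [NormedSpace ℝ E] [Nontrivial E]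
    (z : E) {r : ℝ} (hr : 0 < r) : ENNReal.ofReal r ≤ Metric.ediam (Metric.ball z r) := by
  refine ENNReal.ofReal_le_of_le_toReal ?_
  have := Metric.diam_ball_eq z hr.le
  rw [Metric.diam] at this
  linarith

/-- The index `n : ℕ` stands for the `(n + 1)`-st term, so that `-n ln N / ln s_n` for `n ≥ 1`
reads `-(n + 1) ln N / ln (s n)` for `n ≥ 0`. Both limits are taken in the extended reals. -/
theorem proposition4 (p N : ℕ) (hN : 2 ≤ N)
    (s : ℕ → ℝ) (hs_pos : ∀ n, 0 < s n) (hs_sum : Summable s)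
    (d : ℕ → Fin N → EuclideanSpace ℝ (Fin p))
    (hd_zero : ∀ n, (0 : EuclideanSpace ℝ (Fin p)) ∈ Set.range (d n))
    (hkappa : BddAbove (Set.range fun n => maxGap (d n)))
    (htau : 0 < tau d)
    (hdecay : ∃ M : ℝ, M < 1 ∧ ∀ n, kappa d * tailSum s n / (tau d * s n) ≤ M) :
    ((dimH (sumSet s d) : ℝ≥0∞) : EReal) =
        liminf (fun n : ℕ => ((-((n : ℝ) + 1) * Real.log N / Real.log (s n) : ℝ) : EReal)) atTop ∧
      ((dimP (sumSet s d) : ℝ≥0∞) : EReal) =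
        limsup (fun n : ℕ => ((-((n : ℝ) + 1) * Real.log N / Real.log (s n) : ℝ) : EReal)) atTop := by
  have h01 : (⟨0, by omega⟩ : Fin N) ≠ ⟨1, by omega⟩ := by simp
  have hκ0 : 0 ≤ kappa d := (norm_nonneg _).trans (norm_sub_le_kappa hkappa 0 h01)
  -- Two digits at positive distance force `p ≥ 1`.
  have : Nontrivial (EuclideanSpace ℝ (Fin p)) :=
    ⟨_, _, sub_ne_zero.1 (norm_pos_iff.1 (htau.trans_le (tau_le_norm_sub d 0 h01)))⟩
  obtain ⟨M, hM, hdecay⟩ := hdecay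
  have hsummable := summable_smul_digit hs_pos hs_sum hd_zero hkappa hκ0
  have h := isSeparatedCoding_digitSum hN hs_pos hs_sum hkappa htau hsummable hM hdecay
  rw [← range_digitSum hsummable]
  exact ⟨h.dimH_range_eq hN, h.dimP_range_eq hN fun z r hr => ofReal_le_ediam_ball z hr⟩
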